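/- Let $N,d,w\ge 1$ be integers, $I=\{1,\dots,N\}$, and let $p_1\ge p_2\ge\dots\ge p_N$ be a probability distribution on $I$. A sketch has $d$ rows of $w$ counters, all $0$ at time $0$. Row $r$ uses a random hash function $h_r:I\to\{1,\dots,w\}$; the functions $h_1,\dots,h_d$ are independent, and each is pairwise independent, that is, $\mathbb P(h_r(x)=a,\,h_r(y)=b)=1/w^2$ for all items $x\ne y$ and all $a,b\in\{1,\dots,w\}$. The requests $Z(1),Z(2),\dots$ are i.i.d. with $\mathbb P(Z(s)=x)=p_x$ for $x\in I$, and are independent of $(h_1,\dots,h_d)$. Let $c_x^r(t)$ be the value at time $t$ of the counter $h_r(x)$ of row $r$, and let $\hat n_x(t)=\min_{1\le r\le d}c_x^r(t)$. In the Count-Min Sketch with Conservative Updates (CMS-CU), when item $x$ is requested at time $t$, for every row $r$ the counter $h_r(x)$ of row $r$ takes the value $\max\bigl(c_x^r(t-1),\,\hat n_x(t-1)+1\bigr)$, and all other counters keep their values. For $j\ne i$ and $s\ge 1$, the contribution of item $j$ to item $i$'s counter in row $r$ at time $s$ is $$\delta_{i,j}^r(s)=\mathbf 1\bigl(Z(s)=j,\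 h_r(i)=h_r(j),\ \hat n_j(s-1)=c_i^r(s-1)\bigr).$$ Define $$\mathcal A(x)=\min_{k=0,\dots,w-1}\left(\frac{\sum_{e>k}p_e}{(w-k)\,x}+\frac kw\right)\ \text{ for } x>0,\qquad \mathcal A(0)=1,$$ and $\gamma_{i,j}=1$ if $j<i$, $\gamma_{i,j}=\min\bigl(\mathcal A(p_i-p_j)^{d-1},\,1\bigr)$ if $j>i$. Then for all items $i\ne j$ there are constants $\alpha_{i,j}>0$ and $\beta_{i,j}\ge 0$, not depending on $r$ or $s$, such that for every row $r$ and every time $s\ge 1$ $$\mathbb E[\delta_{i,j}^r(s)]\le\frac{p_j}{w}\Bigl(\gamma_{i,j}+\beta_{i,j}\,e^{-\alpha_{i,j}(s-1)}\Bigr).$$ -/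

import Mathlib

open MeasureTheory ProbabilityTheory

namespace CMSCU

/-- Minimum over the rows of the counters to which item `x` is hashed, when the array of counters
is `C` (one row of `w` counters for each of the `d` hash functions). -/
def minCounter {N d w : ℕ} [NeZero d] (hash : Fin d → Fin N → Fin w) (C : Fin d → Fin w → ℕ)
    (x : Fin N) : ℕ :=
  Finset.univ.inf' Finset.univ_nonempty fun f : Fin d => C f (hash f x)

/-- Conservative update of the array of counters at a request for item `x`: in each row `r`, the
counter `hash r x` becomes the maximum of its old value and of one plus the minimum of the
counters of `x`; all other counters keep their value. -/
def update {N d w : ℕ} [NeZero d] (hash : Fin d → Fin N → Fin w) (C : Fin d → Fin w → ℕ)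
    (x : Fin N) : Fin d → Fin w → ℕ :=
  fun r b => if b = hash r x then max (C r b) (minCounter hash C x + 1) else C r b

/-- The array of counters after the first `t` requests `z 1, …, z t` of the stream `z`
(times start at `1`; the value `z 0` is never used). -/
def counters {N d w : ℕ} [NeZero d] (hash : Fin d → Fin N → Fin w) (z : ℕ → Fin N) :
    ℕ → Fin d → Fin w → ℕ
  | 0 => fun _ _ => 0
  | t + 1 => update hash (counters hash z t) (z (t + 1))

/-- `c_i^r(t)`: the value at time `t` of the counter of row `r` to which item `i` is hashed. -/
def itemCounter {N d w : ℕ} [NeZero d] (hash : Fin d → Fin N → Fin w) (z : ℕ → Fin N)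
    (i : Fin N) (r : Fin d) (t : ℕ) : ℕ :=
  counters hash z t r (hash r i)

/-- The estimate at time `t` of the number of occurrences of item `i`:
the minimum over `r` of `c_i^r(t)`. -/
def estimate {N d w : ℕ} [NeZero d] (hash : Fin d → Fin N → Fin w) (z : ℕ → Fin N)
    (i : Fin N) (t : ℕ) : ℕ :=
  Finset.univ.inf' Finset.univ_nonempty fun r : Fin d => itemCounter hash z i r t

/-- `δ_{i,j}^r(s)`, the contribution of item `j` to the counter of item `i` in row `r` at time
`s ≥ 1`: the indicator that `j` is requested at time `s`, that it collides with `i` in row `r`,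
and that its estimate at time `s - 1` equals the value of this common counter. -/
def delta {N d w : ℕ} [NeZero d] (hash : Fin d → Fin N → Fin w) (z : ℕ → Fin N)
    (i j : Fin N) (r : Fin d) (s : ℕ) : ℝ :=
  if z s = j ∧ hash r i = hash r j ∧ estimate hash z j (s - 1) = itemCounter hash z i r (s - 1)
  then 1 else 0

/-- A random function `H` from the items to the `w` counters of a row is a pairwise independent
hash function: the values at two distinct items are independent and uniform. -/
def IsPairwiseIndependentHash {Ω : Type*} [MeasurableSpace Ω] {N w : ℕ} (μ : Measure Ω)
    (H : Ω → Fin N → Fin w) : Prop :=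
  ∀ x y : Fin N, x ≠ y → ∀ a b : Fin w,
    μ.real {ω | H ω x = a ∧ H ω y = b} = 1 / (w : ℝ) ^ 2

/-- `𝒜_k(x)`. Items are listed by decreasing popularity and `e : Fin N` has rank `e + 1`, so the
items of rank greater than `k` are those with `k ≤ e`. -/
noncomputable def boundAt {N : ℕ} (w : ℕ) (p : Fin N → ℝ) (k : ℕ) (x : ℝ) : ℝ :=
  (∑ e ∈ Finset.univ.filter (fun e : Fin N => k ≤ (e : ℕ)), p e) / (((w : ℝ) - (k : ℝ)) * x) + (k : ℝ) / (w : ℝ)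

/-- `𝒜(x)`: the minimum of `𝒜_k(x)` over `k = 0, …, w - 1`, with `𝒜(0) = 1`. -/
noncomputable def bound {N : ℕ} (w : ℕ) [NeZero w] (p : Fin N → ℝ) (x : ℝ) : ℝ :=
  if x = 0 then 1
  else Finset.univ.inf' Finset.univ_nonempty fun k : Fin w => boundAt w p k x

/-- The attenuation factor `γ_{i,j}`, for a sketch with `d` rows of `w` counters. -/
noncomputable def gamma {N : ℕ} (d w : ℕ) [NeZero w] (p : Fin N → ℝ) (i j : Fin N) : ℝ :=
  if j ≤ i then 1 else min (bound w p (p i - p j) ^ (d - 1)) 1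

end CMSCU

/-! A nonzero contribution forces `j` to be requested and to collide with `i` in row `r`, which has
probability `p j / w`; this settles `j < i`. For `j > i`, the common counter is at least the number
of requests for `i`, and, being minimal for `j`, it is at most the number of requests for the class
of `j` (the items hashed with it) in every row. Either every row other than `r` puts items of weight
at least `p i - p j` with `j`, and independence of the rows with a union and Markov bound gives the
power of `bound`; or some class lighter than `p i` has kept pace with `i`, which is exponentially
unlikely by Hoeffding. A union over all light sets makes the second event free of the hash
functions, so only the request at time `s` must be separated from the past. -/

namespace CMSCU

/-! ### Pathwise bounds on the counters -/

section Deterministic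

variable {N d w : ℕ} [NeZero d] (hash : Fin d → Fin N → Fin w) (z : ℕ → Fin N)

lemma minCounter_le (C : Fin d → Fin w → ℕ) (x : Fin N) (r : Fin d) :
    minCounter hash C x ≤ C r (hash r x) :=
  Finset.inf'_le _ (Finset.mem_univ r)

/-- A request raises a counter by at most one, since the minimum never exceeds the counter being
updated. -/
lemma counters_le_card (t : ℕ) (r : Fin d) (b : Fin w) :
    counters hash z t r b ≤ ∑ n ∈ Finset.range t, if hash r (z (n + 1)) = b then 1 else 0 := by
  induction t with
  | zero => simp [counters]
  | succ t ih =>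
    rw [Finset.sum_range_succ]
    simp only [counters, update]
    by_cases hb : b = hash r (z (t + 1))
    · subst hb
      have := minCounter_le hash (counters hash z t) (z (t + 1)) r
      simp only [if_true]
      omega
    · simpa [hb, Ne.symm hb] using ih

/-- The induction runs over all rows at once: the update uses the minimum over rows, so the bound is
needed in each of them. -/
lemma card_le_itemCounter (t : ℕ) (i : Fin N) (r : Fin d) :
    (∑ n ∈ Finset.range t, if z (n + 1) = i then 1 else 0) ≤ itemCounter hash z i r t := by
  induction t generalizing r with
  | zero => simp
  | succ t ih =>
    rw [Finset.sum_range_succ]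
    have hmin : (∑ n ∈ Finset.range t, if z (n + 1) = i then 1 else 0) ≤
        minCounter hash (counters hash z t) i :=
      Finset.le_inf' _ _ fun r _ => ih r
    have hr := ih r
    simp only [itemCounter, counters, update] at hr ⊢
    by_cases hz : z (t + 1) = i
    · simp only [hz, if_true]
      omega
    · simp only [hz, if_false]
      split_ifs <;> omega

/-- The increment of the lead of the requests in `S` over the requests for `i`. -/
def lead (S : Finset (Fin N)) (i x : Fin N) : ℝ :=
  (if x ∈ S then 1 else 0) - if x = i then 1 else 0

/-- If the counter shared by `i` and `j` in row `r` is minimal for `j`, then in every row the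
items colliding with `j` have been requested at least as often as `i`. -/
lemma lead_nonneg_of_estimate_eq {i j : Fin N} {r : Fin d} {t : ℕ}
    (h : estimate hash z j t = itemCounter hash z i r t) (r' : Fin d) :
    0 ≤ ∑ n ∈ Finset.range t,
      lead (Finset.univ.filter fun e => hash r' e = hash r' j) i (z (n + 1)) := by
  have h1 : estimate hash z j t ≤ itemCounter hash z j r' t :=
    Finset.inf'_le _ (Finset.mem_univ r')
  have h2 := counters_le_card hash z t r' (hash r' j)
  have h3 := card_le_itemCounter hash z t i r
  have h4 := (h3.trans (h ▸ h1)).trans h2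
  have h5 : (∑ n ∈ Finset.range t, if z (n + 1) = i then (1 : ℝ) else 0) ≤
      ∑ n ∈ Finset.range t, if hash r' (z (n + 1)) = hash r' j then (1 : ℝ) else 0 := by
    exact_mod_cast h4
  simp only [lead, Finset.sum_sub_distrib, Finset.mem_filter, Finset.mem_univ, true_and]
  linarith

end Deterministic

/-! ### Collision probabilities -/

section Hash

variable {Ω : Type*} [MeasurableSpace Ω] {μ : Measure Ω} [IsProbabilityMeasure μ] {N w : ℕ}

lemma measureReal_collision [NeZero w] {H : Ω → Fin N → Fin w} (H_meas : Measurable H)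
    (H_pair : IsPairwiseIndependentHash μ H) {x y : Fin N} (hxy : x ≠ y) :
    μ.real {ω | H ω x = H ω y} = 1 / (w : ℝ) := by
  have hU : {ω | H ω x = H ω y} = ⋃ a ∈ (Finset.univ : Finset (Fin w)),
      {ω | H ω x = a ∧ H ω y = a} := by
    ext ω; simp [eq_comm]
  rw [hU, measureReal_biUnion_finset]
  · have hw : (w : ℝ) ≠ 0 := by exact_mod_cast NeZero.ne w
    simp only [H_pair x y hxy, Finset.sum_const, Finset.card_univ, Fintype.card_fin, nsmul_eq_mul]
    field_simp
  · intro a _ b _ hab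
    refine Set.disjoint_left.2 ?_
    rintro ω ⟨h1, -⟩ ⟨h2, -⟩
    exact hab (h1.symm.trans h2)
  · intro a _
    exact H_meas (Set.toFinite {η : Fin N → Fin w | η x = a ∧ η y = a}).measurableSet

/-- The hash functions for which the items colliding with `j` have total weight at least `x`. -/
def heavy (w : ℕ) (p : Fin N → ℝ) (j : Fin N) (x : ℝ) : Set (Fin N → Fin w) :=
  {η | x ≤ ∑ e ∈ Finset.univ.filter (fun e => e ≠ j ∧ η e = η j), p e}

/-- Either one of the `k` most popular items collides with `j` (union bound, `k / w`), or the
remaining items alone carry weight `x` (Markov). -/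
lemma measureReal_heavy_le_boundAt [NeZero w] {H : Ω → Fin N → Fin w} (H_meas : Measurable H)
    (H_pair : IsPairwiseIndependentHash μ H) {p : Fin N → ℝ} (hp : ∀ e, 0 ≤ p e) (j : Fin N)
    {x : ℝ} (hx : 0 < x) {k : ℕ} (hk : k < w) :
    μ.real (H ⁻¹' heavy w p j x) ≤ boundAt w p k x := by
  have hw : (0 : ℝ) < w := by exact_mod_cast NeZero.pos w
  have hkw : (0 : ℝ) < (w : ℝ) - k := by
    rw [sub_pos]; exact_mod_cast hk
  set top : Finset (Fin N) := Finset.univ.filter fun e => (e : ℕ) < k ∧ e ≠ j with htop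
  set low : Finset (Fin N) := Finset.univ.filter fun e => k ≤ (e : ℕ) ∧ e ≠ j with hlow
  set g : Ω → ℝ := fun ω => ∑ e ∈ low, p e * Set.indicator {ω | H ω e = H ω j} 1 ω with hg
  have hmeas : ∀ e, MeasurableSet {ω | H ω e = H ω j} := fun e =>
    H_meas (Set.toFinite {η : Fin N → Fin w | η e = η j}).measurableSet
  have hint : ∀ e, Integrable (fun ω => p e * Set.indicator {ω | H ω e = H ω j} (1 : Ω → ℝ) ω) μ :=
    fun e => ((integrable_const (1 : ℝ)).indicator (hmeas e)).const_mul _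
  have hsub : H ⁻¹' heavy w p j x ⊆ (⋃ e ∈ top, {ω | H ω e = H ω j}) ∪ {ω | x ≤ g ω} := by
    intro ω hω
    by_cases hc : ∃ e ∈ top, H ω e = H ω j
    · left; simpa using hc
    · right
      push Not at hc
      change x ≤ _ at hω
      refine hω.trans_eq ?_
      simp only [hg, Set.indicator_apply, Set.mem_ofPred_eq, Pi.one_apply, mul_ite, mul_one,
        mul_zero, ← Finset.sum_filter]
      refine Finset.sum_congr ?_ fun _ _ => rfl
      ext e
      have := hc e
      simp only [htop, hlow, Finset.mem_filter, Finset.mem_univ, true_and] at this ⊢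
      grind
  have hT : μ.real (⋃ e ∈ top, {ω | H ω e = H ω j}) ≤ k / w := by
    refine (measureReal_biUnion_finset_le _ _).trans ?_
    rw [Finset.sum_congr rfl fun e he =>
      measureReal_collision H_meas H_pair (Finset.mem_filter.1 he).2.2]
    have hcard : top.card ≤ k := by
      have : (top.map Fin.valEmbedding) ⊆ Finset.range k := by
        intro n hn
        simp only [Finset.mem_map, htop, Finset.mem_filter] at hn
        obtain ⟨e, he, rfl⟩ := hn
        simpa using he.2.1
      simpa using Finset.card_le_card this
    rw [Finset.sum_const, nsmul_eq_mul, mul_one_div]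
    gcongr
  have hL : μ.real {ω | x ≤ g ω} ≤
      (∑ e ∈ Finset.univ.filter (fun e : Fin N => k ≤ (e : ℕ)), p e) / (((w : ℝ) - k) * x) := by
    have hmk := mul_meas_ge_le_integral_of_nonneg (μ := μ) (f := g)
      (Filter.Eventually.of_forall fun ω => Finset.sum_nonneg fun e _ =>
        mul_nonneg (hp e) (Set.indicator_nonneg (fun _ _ => zero_le_one) _))
      (integrable_finsetSum _ fun e _ => hint e) x
    have hval : ∫ ω, g ω ∂μ = (∑ e ∈ low, p e) / w := by
      rw [integral_finsetSum _ fun e _ => hint e, Finset.sum_div]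
      refine Finset.sum_congr rfl fun e he => ?_
      rw [integral_const_mul, integral_indicator_one (hmeas e),
        measureReal_collision H_meas H_pair (Finset.mem_filter.1 he).2.2, mul_one_div]
    have hle : ∑ e ∈ low, p e ≤ ∑ e ∈ Finset.univ.filter (fun e : Fin N => k ≤ (e : ℕ)), p e :=
      Finset.sum_le_sum_of_subset_of_nonneg
        (fun e he => by
          simp only [hlow, Finset.mem_filter] at he ⊢
          exact ⟨he.1, he.2.1⟩) fun e _ _ => hp e
    rw [hval, le_div_iff₀ hw] at hmk
    rw [le_div_iff₀ (mul_pos hkw hx)]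
    have hk0 : (0 : ℝ) ≤ k := k.cast_nonneg
    -- Markov yields the stronger denominator `w * x`; it is weakened to match `boundAt`.
    calc μ.real {ω | x ≤ g ω} * (((w : ℝ) - k) * x)
        ≤ μ.real {ω | x ≤ g ω} * ((w : ℝ) * x) := by gcongr; linarith
      _ = x * μ.real {ω | x ≤ g ω} * w := by ring
      _ ≤ _ := hmk.trans hle
  calc μ.real (H ⁻¹' heavy w p j x)
      ≤ μ.real ((⋃ e ∈ top, {ω | H ω e = H ω j}) ∪ {ω | x ≤ g ω}) := measureReal_mono hsub
    _ ≤ _ := measureReal_union_le _ _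
    _ ≤ _ := by rw [boundAt, add_comm]; exact add_le_add hL hT

lemma measureReal_heavy_le_bound [NeZero w] {H : Ω → Fin N → Fin w} (H_meas : Measurable H)
    (H_pair : IsPairwiseIndependentHash μ H) {p : Fin N → ℝ} (hp : ∀ e, 0 ≤ p e) (j : Fin N)
    {x : ℝ} (hx : 0 ≤ x) :
    μ.real (H ⁻¹' heavy w p j x) ≤ bound w p x := by
  rw [bound]
  split_ifs with h0
  · exact measureReal_le_one
  · exact Finset.le_inf' _ _ fun k _ =>
      measureReal_heavy_le_boundAt H_meas H_pair hp j (lt_of_le_of_ne hx (Ne.symm h0)) k.2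

/-- The event that `i` and `j` collide in row `r` while `j` collides with heavy items in all
other rows. -/
lemma measureReal_collision_and_heavy_le [NeZero w] {d : ℕ} {h : Fin d → Ω → Fin N → Fin w}
    (h_meas : ∀ r, Measurable (h r)) (h_indep : iIndepFun h μ)
    (h_pairwise : ∀ r, IsPairwiseIndependentHash μ (h r)) {p : Fin N → ℝ} (hp : ∀ e, 0 ≤ p e)
    {i j : Fin N} (hij : i ≠ j) {x : ℝ} (hx : 0 ≤ x) (r : Fin d) :
    μ.real {ω | h r ω i = h r ω j ∧ ∀ r', r' ≠ r → h r' ω ∈ heavy w p j x} ≤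
      1 / (w : ℝ) * min (bound w p x ^ (d - 1)) 1 := by
  set E : Fin d → Set (Fin N → Fin w) := fun r' =>
    if r' = r then {η | η i = η j} else heavy w p j x with hE
  have hset : {ω | h r ω i = h r ω j ∧ ∀ r', r' ≠ r → h r' ω ∈ heavy w p j x} =
      ⋂ r' ∈ (Finset.univ : Finset (Fin d)), h r' ⁻¹' E r' := by
    ext ω
    simp only [Set.mem_ofPred_eq, Finset.mem_univ, Set.iInter_true, Set.mem_iInter,
      Set.mem_preimage]
    constructor
    · rintro ⟨h1, h2⟩ r'
      by_cases hr : r' = r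
      · subst hr; simpa [hE] using h1
      · simpa [hE, hr] using h2 r' hr
    · intro hω
      refine ⟨by simpa [hE] using hω r, fun r' hr => by simpa [hE, hr] using hω r'⟩
  have hprod : μ.real (⋂ r' ∈ (Finset.univ : Finset (Fin d)), h r' ⁻¹' E r') =
      ∏ r', μ.real (h r' ⁻¹' E r') := by
    rw [measureReal_def, h_indep.measure_inter_preimage_eq_mul Finset.univ
      (fun r' _ => (Set.toFinite (E r')).measurableSet), ENNReal.toReal_prod]
    rfl
  rw [hset, hprod, ← Finset.mul_prod_erase _ _ (Finset.mem_univ r)]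
  have hr : μ.real (h r ⁻¹' E r) = 1 / (w : ℝ) := by
    rw [← measureReal_collision (h_meas r) (h_pairwise r) hij]
    simp [hE]
  rw [hr]
  have herase : ∏ r' ∈ Finset.univ.erase r, μ.real (h r' ⁻¹' E r') =
      ∏ r' ∈ Finset.univ.erase r, μ.real (h r' ⁻¹' heavy w p j x) :=
    Finset.prod_congr rfl fun r' hr' => by simp [hE, Finset.ne_of_mem_erase hr']
  rw [herase]
  refine mul_le_mul_of_nonneg_left (le_min ?_ ?_) (by positivity)
  · refine (Finset.prod_le_prod (fun _ _ => measureReal_nonneg) fun r' _ =>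
      measureReal_heavy_le_bound (h_meas r') (h_pairwise r') hp j hx).trans_eq ?_
    simp
  · exact Finset.prod_le_one (fun _ _ => measureReal_nonneg) fun _ _ => measureReal_le_one

end Hash

/-! ### Concentration of the request counts -/

section Requests

variable {Ω : Type*} [MeasurableSpace Ω] {μ : Measure Ω} [IsProbabilityMeasure μ] {N : ℕ}

lemma integral_lead {X : Ω → Fin N} (X_meas : Measurable X) {p : Fin N → ℝ}
    (X_law : ∀ x, μ.real {ω | X ω = x} = p x) (S : Finset (Fin N)) (i : Fin N) :
    ∫ ω, lead S i (X ω) ∂μ = ∑ e ∈ S, p e - p i := by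
  rw [← integral_map (f := lead S i) X_meas.aemeasurable
    (measurable_of_finite _).aestronglyMeasurable, integral_fintype .of_finite]
  have hm : ∀ x, (μ.map X).real {x} = p x := fun x => by
    rw [map_measureReal_apply X_meas (measurableSet_singleton x), ← X_law x]
    rfl
  simp [hm, lead, mul_sub, Finset.sum_sub_distrib, Finset.sum_ite_mem]

/-- If `S` is less popular than `i`, it is exponentially unlikely that `S` is requested at least
as often as `i`. -/
lemma measureReal_lead_nonneg_le {X : ℕ → Ω → Fin N} (X_meas : ∀ n, Measurable (X n))
    (X_indep : iIndepFun X μ) {p : Fin N → ℝ} (X_law : ∀ n x, μ.real {ω | X n ω = x} = p x)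
    {S : Finset (Fin N)} {i : Fin N} (hS : ∑ e ∈ S, p e < p i) (t : ℕ) :
    μ.real {ω | 0 ≤ ∑ n ∈ Finset.range t, lead S i (X n ω)} ≤
      Real.exp (-((p i - ∑ e ∈ S, p e) ^ 2 / 2) * t) := by
  set m : ℝ := p i - ∑ e ∈ S, p e with hm
  have hm0 : 0 < m := sub_pos.2 hS
  have hlead : Measurable (lead S i) := measurable_of_finite _
  have hsub : ∀ n, HasSubgaussianMGF (fun ω => lead S i (X n ω) + m) 1 μ := fun n => by
    -- Hoeffding's lemma: values in `[-1, 1]` give variance proxy `1`, and the mean is `-m`.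
    have := hasSubgaussianMGF_of_mem_Icc (μ := μ) (X := fun ω => lead S i (X n ω))
      (a := -1) (b := 1) (hlead.comp (X_meas n)).aemeasurable
      (Filter.Eventually.of_forall fun ω => by
        simp only [lead, Set.mem_Icc]; split_ifs <;> norm_num)
    rw [integral_lead (X_meas n) (X_law n)] at this
    convert this using 2
    · rw [hm]; ring
    · ext; norm_num
  have hind : iIndepFun (fun n ω => lead S i (X n ω) + m) μ :=
    X_indep.comp (fun _ x => lead S i x + m) fun _ => measurable_of_finite _
  have hmain := HasSubgaussianMGF.measure_sum_range_ge_le_of_iIndepFun hind (c := 1) (n := t)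
    (fun n _ => hsub n) (ε := t * m) (by positivity)
  have hset : {ω | (t : ℝ) * m ≤ ∑ n ∈ Finset.range t, (lead S i (X n ω) + m)} =
      {ω | 0 ≤ ∑ n ∈ Finset.range t, lead S i (X n ω)} := by
    ext ω
    simp [Finset.sum_add_distrib]
  rw [hset] at hmain
  refine hmain.trans_eq (congrArg Real.exp ?_)
  rcases t.eq_zero_or_pos with rfl | ht
  · simp
  · have : (t : ℝ) ≠ 0 := by positivity
    simp only [NNReal.coe_one]
    field_simp

/-- Exponential decay, uniformly over the sets less popular than `i`. -/
lemma exists_measureReal_exists_lead_nonneg_le {X : ℕ → Ω → Fin N}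
    (X_meas : ∀ n, Measurable (X n)) (X_indep : iIndepFun X μ) {p : Fin N → ℝ}
    (X_law : ∀ n x, μ.real {ω | X n ω = x} = p x) (i : Fin N) :
    ∃ α C : ℝ, 0 < α ∧ 0 ≤ C ∧ ∀ t : ℕ,
      μ.real {ω | ∃ S : Finset (Fin N), ∑ e ∈ S, p e < p i ∧
        0 ≤ ∑ n ∈ Finset.range t, lead S i (X n ω)} ≤ C * Real.exp (-α * t) := by
  set T : Finset (Finset (Fin N)) := Finset.univ.filter fun S => ∑ e ∈ S, p e < p i with hT
  -- Any small enough `α > 0` lies below finitely many positive rates; this also covers empty `T`.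
  obtain ⟨α, hα, hα0⟩ : ∃ α : ℝ, (∀ S ∈ T, α ≤ (p i - ∑ e ∈ S, p e) ^ 2 / 2) ∧ 0 < α := by
    refine (((Finset.eventually_all T).2 fun S hS => ?_).and
      (self_mem_nhdsWithin : ∀ᶠ α in nhdsWithin (0 : ℝ) (Set.Ioi 0), α ∈ Set.Ioi (0 : ℝ))).exists
    have : 0 < p i - ∑ e ∈ S, p e := sub_pos.2 (Finset.mem_filter.1 hS).2
    exact (Filter.Tendsto.eventually_le_const (by positivity) Filter.tendsto_id).filter_mono
      nhdsWithin_le_nhds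
  refine ⟨α, T.card, hα0, by positivity, fun t => ?_⟩
  have hset : {ω | ∃ S : Finset (Fin N), ∑ e ∈ S, p e < p i ∧
      0 ≤ ∑ n ∈ Finset.range t, lead S i (X n ω)} =
      ⋃ S ∈ T, {ω | 0 ≤ ∑ n ∈ Finset.range t, lead S i (X n ω)} := by
    ext ω; simp [hT]
  rw [hset, ← nsmul_eq_mul, ← Finset.sum_const]
  refine (measureReal_biUnion_finset_le _ _).trans (Finset.sum_le_sum fun S hS => ?_)
  refine (measureReal_lead_nonneg_le X_meas X_indep X_law (Finset.mem_filter.1 hS).2 t).trans ?_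
  gcongr
  exact hα S hS

omit [IsProbabilityMeasure μ] in
/-- The request at time `t` is independent of the earlier ones. -/
lemma measureReal_eq_and_exists_lead_nonneg {X : ℕ → Ω → Fin N} (X_meas : ∀ n, Measurable (X n))
    (X_indep : iIndepFun X μ) (P : Finset (Fin N) → Prop) (i j : Fin N) (t : ℕ) :
    μ.real {ω | X t ω = j ∧ ∃ S, P S ∧ 0 ≤ ∑ n ∈ Finset.range t, lead S i (X n ω)} =
      μ.real {ω | X t ω = j} *
        μ.real {ω | ∃ S, P S ∧ 0 ≤ ∑ n ∈ Finset.range t, lead S i (X n ω)} := by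
  have hind := X_indep.indepFun_finset {t} (Finset.range t) (by simp) X_meas
  set A : Set (({t} : Finset ℕ) → Fin N) := {y | y ⟨t, Finset.mem_singleton_self t⟩ = j}
  set B : Set (Finset.range t → Fin N) := {y | ∃ S, P S ∧ 0 ≤ ∑ n, lead S i (y n)}
  have h := hind.measure_inter_preimage_eq_mul A B (Set.toFinite A).measurableSet
    (Set.toFinite B).measurableSet
  have hB : (fun a (n : Finset.range t) => X n a) ⁻¹' B =
      {ω | ∃ S, P S ∧ 0 ≤ ∑ n ∈ Finset.range t, lead S i (X n ω)} := by
    ext ω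
    simp only [B, Set.mem_preimage, Set.mem_ofPred_eq]
    simp_rw [← Finset.sum_coe_sort (Finset.range t) fun n => lead _ i (X n ω)]
  rw [hB] at h
  simp only [measureReal_def, ← ENNReal.toReal_mul]
  exact congrArg ENNReal.toReal h

end Requests

end CMSCU

/-! ### The bound on the expected contribution -/

theorem lemma1 {Ω : Type*} [MeasurableSpace Ω] (μ : Measure Ω) [IsProbabilityMeasure μ]
    (N d w : ℕ) [NeZero d] [NeZero w]
    (p : Fin N → ℝ) (hp : Antitone p)
    (h : Fin d → Ω → Fin N → Fin w) (Z : ℕ → Ω → Fin N)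
    (h_meas : ∀ r, Measurable (h r))
    (h_indep : iIndepFun h μ)
    (h_pairwise : ∀ r, CMSCU.IsPairwiseIndependentHash μ (h r))
    (Z_meas : ∀ s, 1 ≤ s → Measurable (Z s))
    (Z_indep : iIndepFun (fun n : ℕ => Z (n + 1)) μ)
    (Z_law : ∀ s, 1 ≤ s → ∀ x, μ.real {ω | Z s ω = x} = p x)
    (hZ_indep : IndepFun (fun ω r => h r ω) (fun ω (n : ℕ) => Z (n + 1) ω) μ)
    (i j : Fin N) (hij : j ≠ i) :
    ∃ α β : ℝ, 0 < α ∧ 0 ≤ β ∧ ∀ (r : Fin d) (s : ℕ), 1 ≤ s →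
      ∫ ω, CMSCU.delta (fun r' => h r' ω) (fun s' => Z s' ω) i j r s ∂μ ≤
        p j / (w : ℝ) *
          (CMSCU.gamma d w p i j + β * Real.exp (-α * ((s : ℝ) - 1))) := by
  have hp0 : ∀ e, 0 ≤ p e := fun e => Z_law 1 le_rfl e ▸ measureReal_nonneg
  have hw : (0 : ℝ) < w := by exact_mod_cast NeZero.pos w
  have X_meas : ∀ n, Measurable (Z (n + 1)) := fun n => Z_meas _ (by omega)
  have X_law : ∀ n x, μ.real {ω | Z (n + 1) ω = x} = p x := fun n => Z_law _ (by omega)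
  have hprod : ∀ (U : Set (Fin d → Fin N → Fin w)) (n : ℕ),
      μ.real {ω | Z (n + 1) ω = j ∧ (fun r => h r ω) ∈ U} =
        p j * μ.real {ω | (fun r => h r ω) ∈ U} := fun U n => by
    have := hZ_indep.measure_inter_preimage_eq_mul U ((fun y => y n) ⁻¹' {j})
      (Set.toFinite U).measurableSet (measurable_pi_apply n (measurableSet_singleton j))
    rw [← X_law n j, mul_comm, measureReal_def, measureReal_def, measureReal_def,
      ← ENNReal.toReal_mul]
    refine (congrArg ENNReal.toReal ?_).trans (congrArg ENNReal.toReal this)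
    congr 1
    ext ω
    exact and_comm
  have hdelta : ∀ (r : Fin d) (s : ℕ) (G : Set Ω),
      (∀ ω, Z s ω = j → h r ω i = h r ω j →
        CMSCU.estimate (fun r' => h r' ω) (fun s' => Z s' ω) j (s - 1) =
          CMSCU.itemCounter (fun r' => h r' ω) (fun s' => Z s' ω) i r (s - 1) → ω ∈ G) →
      ∫ ω, CMSCU.delta (fun r' => h r' ω) (fun s' => Z s' ω) i j r s ∂μ ≤ μ.real G := by
    intro r s G hG
    -- Passing to a measurable hull avoids proving that `G` is measurable.
    rw [measureReal_def, ← measure_toMeasurable, ← measureReal_def,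
      ← integral_indicator_one (measurableSet_toMeasurable μ G)]
    refine integral_mono_of_nonneg (Filter.Eventually.of_forall fun ω => ?_)
      ((integrable_const (1 : ℝ)).indicator (measurableSet_toMeasurable μ G))
      (Filter.Eventually.of_forall fun ω => ?_)
    · simp only [CMSCU.delta, Pi.zero_apply]; split_ifs <;> norm_num
    · simp only [CMSCU.delta]
      split_ifs with hc
      · rw [Set.indicator_of_mem (subset_toMeasurable μ G (hG ω hc.1 hc.2.1 hc.2.2))]; rfl
      · exact Set.indicator_nonneg (fun _ _ => zero_le_one) _
  by_cases hji : j ≤ i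
  · refine ⟨1, 0, one_pos, le_rfl, fun r s hs => ?_⟩
    obtain ⟨t, rfl⟩ : ∃ t, s = t + 1 := ⟨s - 1, by omega⟩
    refine (hdelta r (t + 1) {ω | Z (t + 1) ω = j ∧ (fun r => h r ω) ∈ {η : Fin d → Fin N → Fin w | η r i = η r j}}
      fun ω h1 h2 _ => ⟨h1, h2⟩).trans_eq ?_
    rw [hprod]
    have : μ.real {ω | (fun r => h r ω) ∈ {η : Fin d → Fin N → Fin w | η r i = η r j}} = 1 / w :=
      CMSCU.measureReal_collision (h_meas r) (h_pairwise r) hij.symm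
    rw [this, CMSCU.gamma, if_pos hji]
    ring
  · have hpij : 0 ≤ p i - p j := sub_nonneg.2 (hp (not_le.1 hji).le)
    obtain ⟨α, C, hα, hC, hdecay⟩ :=
      CMSCU.exists_measureReal_exists_lead_nonneg_le X_meas Z_indep X_law i
    -- The factor `w` compensates for dropping the collision in row `r` from the light event.
    refine ⟨α, w * C, hα, by positivity, fun r s hs => ?_⟩
    obtain ⟨t, rfl⟩ : ∃ t, s = t + 1 := ⟨s - 1, by omega⟩
    set U : Set (Fin d → Fin N → Fin w) :=
      {η | η r i = η r j ∧ ∀ r', r' ≠ r → η r' ∈ CMSCU.heavy w p j (p i - p j)} with hU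
    have hbound := hdelta r (t + 1) ({ω | Z (t + 1) ω = j ∧ (fun r => h r ω) ∈ U} ∪
        {ω | Z (t + 1) ω = j ∧ ∃ S : Finset (Fin N), ∑ e ∈ S, p e < p i ∧
          0 ≤ ∑ n ∈ Finset.range t, CMSCU.lead S i (Z (n + 1) ω)}) fun ω h1 h2 h3 => by
      by_cases hc : (fun r => h r ω) ∈ U
      · exact Or.inl ⟨h1, hc⟩
      · right
        obtain ⟨r', hr'⟩ : ∃ r', h r' ω ∉ CMSCU.heavy w p j (p i - p j) := by
          by_contra! hall
          exact hc ⟨h2, fun r' _ => hall r'⟩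
        -- The light set is the whole class of `j` in row `r'`; `j` itself adds `p j`, hence the
        -- threshold `p i - p j`.
        refine ⟨h1, _, ?_, CMSCU.lead_nonneg_of_estimate_eq _ _ h3 r'⟩
        have hlt : ∑ e ∈ Finset.univ.filter (fun e => e ≠ j ∧ h r' ω e = h r' ω j), p e <
            p i - p j := not_le.1 hr'
        have hsplit : (Finset.univ.filter fun e => h r' ω e = h r' ω j) =
            insert j (Finset.univ.filter fun e => e ≠ j ∧ h r' ω e = h r' ω j) := by
          ext e
          by_cases he : e = j <;> simp [he]
        rw [hsplit, Finset.sum_insert (by simp)]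
        linarith
    refine (hbound.trans (measureReal_union_le _ _)).trans ?_
    rw [hprod, CMSCU.measureReal_eq_and_exists_lead_nonneg X_meas Z_indep
      (fun S => ∑ e ∈ S, p e < p i), X_law]
    have hUle : μ.real {ω | (fun r => h r ω) ∈ U} ≤ 1 / (w : ℝ) * CMSCU.gamma d w p i j := by
      rw [CMSCU.gamma, if_neg hji]
      exact CMSCU.measureReal_collision_and_heavy_le h_meas h_indep h_pairwise hp0 hij.symm
        hpij r
    calc _ ≤ p j * (1 / (w : ℝ) * CMSCU.gamma d w p i j) + p j * (C * Real.exp (-α * t)) := by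
          have := hp0 j
          gcongr
          exact hdecay t
      _ = _ := by
          push_cast
          rw [add_sub_cancel_right]
          field_simp
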